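/- Let $p\ge 3$ and $n\ge 1$ be integers and let $X\sim N_p(\theta,\sigma^2 I_p)$ and $S\sim\sigma^2\chi^2_n$ be independent, with $\theta\in\mathbb R^p$ and $\sigma>0$ unknown. Put $W=\|X\|^2/S$. Let $\phi$ be a function that is absolutely continuous on every compact subinterval of $(0,\infty)$, let $\delta_\phi=(1-\phi(W)/W)X$, and let $R(\delta_\phi)=E\|\delta_\phi-\theta\|^2$. Assume that $\delta_\phi$ improves on $X$, that is, $E\|\delta_\phi-\theta\|^2\le E\|X-\theta\|^2$ for all $(\theta,\sigma)$, with strict inequality for at least one $(\theta,\sigma)$. Let $R^*(\delta_\phi)=p\sigma^2-R(\delta_\phi)$ be the risk reduction. The quotient $R^*(\delta_\phi)/\sigma^2$ depends only on $\lambda=\|\theta\|^2/\sigma^2$; let $\alpha_{p,n}$ be its value at $\lambda=0$, and assume that it is maximized at $\lambda=0$. Define for $W>0$ $$h(W)=(p-2)\frac{\phi(W)}{W}+2\phi'(W),\qquad g(W)=W^{n/2}\int_W^\infty t^{-n/2}\,\frac{h(t)}{t}\,dt,\qquad a(W)=\frac np\Big(g(W)-\frac{\phi(W)^2}{W}\Big),$$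 where the integral is assumed to converge absolutely for every $W>0$. Let $\hat R^*_0(\delta_\phi)=\frac{p}{n}S\,a(W)$ (the standard unbiased estimator, UMVUE, of $R^*(\delta_\phi)$) and, for a function $\psi$, let $\hat R^*(\psi;\delta_\phi)=\frac pn S\,a(W)\psi(W)$. Estimators $T$ of $R^*(\delta_\phi)$ are compared by the risk $E[(T-R^*(\delta_\phi))^2]\in[0,\infty]$. Assume that $a$ is nonincreasing on $(0,\infty)$. Let $W_{p,n}>0$ be the solution of $$\frac{1+W}{a(W)}=\frac{p(n+p+2)}{n}\cdot\frac1{\alpha_{p,n}},$$ and define $$\psi_1(W)=\min\Big(1,\ \frac np\cdot\frac{1+W_{p,n}}{n+p+2}\cdot\frac{\alpha_{p,n}}{a(W)}\Big)\ \text{ if } a(W)>0,\qquad \psi_1(W)=1\ \text{ if } a(W)\le 0 .$$ Then $\hat R^*(\psi_1;\delta_\phi)$ improves on $\hat R^*_0(\delta_\phi)$: for all $(\theta,\sigma)$, $$E\big[(\hat R^*(\psi_1;\delta_\phi)-R^*(\delta_\phi))^2\big]\le E\big[(\hat R^*_0(\delta_\phi)-R^*(\delta_\phi))^2\big],$$ and,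 unless $\psi_1(W)=1$ for all $W>0$ (in which case the two estimators coincide), the inequality is strict at every $(\theta,\sigma)$ at which the left-hand side is finite. -/

import Mathlib

open MeasureTheory ProbabilityTheory Set
open scoped ENNReal

noncomputable section

namespace ShrinkageMSE

/-- The law of `(X, S)`: `X ~ N_p(θ, σ² I_p)` and `S ~ σ² χ²_n` are independent.
The chi-square law with `n` degrees of freedom is the gamma law with shape `n / 2` and
rate `1 / 2`. -/
def model (p n : ℕ) (θ : EuclideanSpace ℝ (Fin p)) (σ : ℝ) :
    Measure (EuclideanSpace ℝ (Fin p) × ℝ) :=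
  (multivariateGaussian θ (σ ^ 2 • (1 : Matrix (Fin p) (Fin p) ℝ))).prod
    ((gammaMeasure ((n : ℝ) / 2) (1 / 2)).map (fun u => σ ^ 2 * u))

/-- The statistic `W = ‖X‖² / S`. -/
def statW {p : ℕ} (z : EuclideanSpace ℝ (Fin p) × ℝ) : ℝ := ‖z.1‖ ^ 2 / z.2

/-- The shrinkage estimator `δ_φ = (1 - φ(W) / W) X`. -/
def delta {p : ℕ} (φ : ℝ → ℝ) (z : EuclideanSpace ℝ (Fin p) × ℝ) : EuclideanSpace ℝ (Fin p) :=
  (1 - φ (statW z) / statW z) • z.1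

/-- The mean squared error `E ‖δ(X, S) - θ‖²` of an estimator `δ` of `θ`. -/
def mse (p n : ℕ) (δ : EuclideanSpace ℝ (Fin p) × ℝ → EuclideanSpace ℝ (Fin p))
    (θ : EuclideanSpace ℝ (Fin p)) (σ : ℝ) : ℝ≥0∞ :=
  ∫⁻ z, ENNReal.ofReal (‖δ z - θ‖ ^ 2) ∂(model p n θ σ)

/-- The estimator `δ` of `θ` improves on `X` under squared error loss. -/
def ImprovesOnX (p n : ℕ)
    (δ : EuclideanSpace ℝ (Fin p) × ℝ → EuclideanSpace ℝ (Fin p)) : Prop :=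
  (∀ (θ : EuclideanSpace ℝ (Fin p)) (σ : ℝ), 0 < σ →
      mse p n δ θ σ ≤ mse p n (fun z => z.1) θ σ) ∧
    ∃ (θ : EuclideanSpace ℝ (Fin p)) (σ : ℝ), 0 < σ ∧
      mse p n δ θ σ < mse p n (fun z => z.1) θ σ

/-- The risk reduction `R*(δ_φ) = p σ² - R(δ_φ)`. -/
def riskReduction (p n : ℕ) (φ : ℝ → ℝ) (θ : EuclideanSpace ℝ (Fin p)) (σ : ℝ) : ℝ :=
  p * σ ^ 2 - (mse p n (delta φ) θ σ).toReal

/-- `α_{p,n}(δ_φ)`: the value of `R*(δ_φ) / σ²` at `λ = ‖θ‖² / σ² = 0`, computed at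
`θ = 0`, `σ = 1` (the quotient depends on `(θ, σ)` only through `λ`). -/
def alpha (p n : ℕ) (φ : ℝ → ℝ) : ℝ := riskReduction p n φ 0 1

/-- `h(W) = (p - 2) φ(W) / W + 2 φ'(W)`. -/
def hFun (p : ℕ) (φ : ℝ → ℝ) (w : ℝ) : ℝ := ((p : ℝ) - 2) * (φ w / w) + 2 * deriv φ w

/-- The integrand `t^{-n/2} h(t) / t` in the definition of `g`. -/
def gIntegrand (p n : ℕ) (φ : ℝ → ℝ) (t : ℝ) : ℝ :=
  t ^ (-((n : ℝ) / 2)) * (hFun p φ t / t)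

/-- `g(W) = W^{n/2} ∫_W^∞ t^{-n/2} h(t) / t dt`. -/
def gFun (p n : ℕ) (φ : ℝ → ℝ) (w : ℝ) : ℝ :=
  w ^ ((n : ℝ) / 2) * ∫ t in Ioi w, gIntegrand p n φ t

/-- `a(W) = (n / p) (g(W) - φ(W)² / W)`. -/
def aFun (p n : ℕ) (φ : ℝ → ℝ) (w : ℝ) : ℝ :=
  (n : ℝ) / p * (gFun p n φ w - φ w ^ 2 / w)

/-- The UMVUE `R̂*₀(δ_φ) = p S a(W) / n` of the risk reduction. -/
def reductionEst0 (p n : ℕ) (φ : ℝ → ℝ) (z : EuclideanSpace ℝ (Fin p) × ℝ) : ℝ :=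
  p * z.2 * aFun p n φ (statW z) / n

/-- The class of estimators `R̂*(ψ; δ_φ) = p S a(W) ψ(W) / n` of the risk reduction. -/
def reductionEst (p n : ℕ) (φ ψ : ℝ → ℝ) (z : EuclideanSpace ℝ (Fin p) × ℝ) : ℝ :=
  p * z.2 * aFun p n φ (statW z) * ψ (statW z) / n

/-- The risk of an estimator `T` of `R*(δ_φ)` under the quadratic loss `(T - R*(δ_φ))²`. -/
def reductionRisk (p n : ℕ) (φ : ℝ → ℝ) (T : EuclideanSpace ℝ (Fin p) × ℝ → ℝ)
    (θ : EuclideanSpace ℝ (Fin p)) (σ : ℝ) : ℝ≥0∞ :=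
  ∫⁻ z, ENNReal.ofReal ((T z - riskReduction p n φ θ σ) ^ 2) ∂(model p n θ σ)

open Classical in
/-- `ψ₁(W) = min (1, (n/p) (1 + W₀)/(n + p + 2) α_{p,n}(δ_φ)/a(W))`, understood as `1` where
`a(W) ≤ 0`; that is, `R̂*₀` is truncated from above at `S (1 + W₀) α_{p,n}(δ_φ) / (n + p + 2)`. -/
def psi1 (p n : ℕ) (φ : ℝ → ℝ) (W₀ w : ℝ) : ℝ :=
  if 0 < aFun p n φ w then
    min 1 ((n : ℝ) / p * ((1 + W₀) / (n + p + 2)) * (alpha p n φ / aFun p n φ w))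
  else 1

end ShrinkageMSE

end

namespace ShrinkageMSE

/-! Write `T₀ = S · (p/n) a(W)` for the unbiased estimator and `κ = (1 + W₀) α / (n + p + 2)`.
Multiplying by `ψ₁` caps the coefficient of `S` at `κ`, so `T₀ = T₁ + d` with `d ≥ 0` supported
where `T₁ = κ S`. Hence `(T₀ - R)² = (T₁ - R)² + d² + 2 d (κ S - R)`, and it suffices that `E[κ S d]
≥ R · E[d]`. The equation for `W₀` says `κ = (p/n) a(W₀)`; since `a` is nonincreasing, `d` vanishes
for `W ≥ W₀`, so `κ S d ≥ α (1 + W) S d / (n + p + 2)`. As `R ≤ α σ²`, all reduces to `E[S² (1 + W)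
k(W)] ≥ (n + p + 2) σ² E[S k(W)]` for `k ≥ 0`, which is `lintegral_mul_snd_le`. To prove that, put
`y = X/√u`, `u = S/σ²`. For fixed `y` the weight in `u` is a gamma kernel of rate `(1 + W)/2` times
`exp(const · √u)`. Averaging over `y` and `-y` turns the exponential into a `cosh`, which increases
in `u`, and an increasing weight can only raise a gamma mean
(`lintegral_gamma_kernel_mul_monotone_le`). Strictness comes from the term `E[d²]`, kept in
`reductionRisk_psi1_add_le`. -/

/-! ### Gamma kernels and a Chebyshev-type inequality -/

lemma lintegral_gamma_kernel {m c : ℝ} (hm : 0 < m) (hc : 0 < c) :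
    ∫⁻ u in Ioi (0 : ℝ), ENNReal.ofReal (u ^ (m - 1) * Real.exp (-(c * u))) =
      ENNReal.ofReal ((1 / c) ^ m * Real.Gamma m) := by
  rw [← Real.integral_rpow_mul_exp_neg_mul_Ioi hm hc, ofReal_integral_eq_lintegral_ofReal]
  · have := integrableOn_rpow_mul_exp_neg_mul_rpow (p := 1) (s := m - 1) (b := c)
      (by linarith) one_pos hc
    simpa [IntegrableOn] using this
  · filter_upwards [ae_restrict_mem measurableSet_Ioi] with u hu
    have : (0 : ℝ) < u := hu
    positivity

/-- A monotone weight increases the mean of a gamma law. -/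
lemma lintegral_gamma_kernel_mul_monotone_le {m c : ℝ} (hm : 0 < m) (hc : 0 < c) {q : ℝ → ℝ}
    (hq : MonotoneOn q (Ioi 0)) (hq0 : ∀ u, 0 ≤ q u) (hqm : Measurable q) :
    ENNReal.ofReal m * ∫⁻ u in Ioi (0 : ℝ),
        ENNReal.ofReal (u ^ (m - 1) * Real.exp (-(c * u)) * q u) ≤
      ∫⁻ u in Ioi (0 : ℝ),
        ENNReal.ofReal (c * u * (u ^ (m - 1) * Real.exp (-(c * u)) * q u)) := by
  -- `s` is the mean of the gamma law. With `q` frozen at `q s` the two sides coincide because `Γ(m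
  -- + 1) = m Γ(m)`; `A` is their common value.
  set s := m / c with hs
  have hs0 : 0 < s := by positivity
  set A : ℝ≥0∞ := ∫⁻ u in Ioi (0 : ℝ),
    ENNReal.ofReal (m * (u ^ (m - 1) * Real.exp (-(c * u)) * q s)) with hA
  have hA1 : A = ENNReal.ofReal (m * q s) * ENNReal.ofReal ((1 / c) ^ m * Real.Gamma m) := by
    rw [hA, ← lintegral_gamma_kernel hm hc, ← lintegral_const_mul _ (by fun_prop)]
    refine lintegral_congr fun u => ?_
    rw [← ENNReal.ofReal_mul (mul_nonneg hm.le (hq0 s))]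
    congr 1
    ring
  have hA2 : A = ∫⁻ u in Ioi (0 : ℝ),
      ENNReal.ofReal (c * u * (u ^ (m - 1) * Real.exp (-(c * u)) * q s)) := by
    have : ∫⁻ u in Ioi (0 : ℝ),
        ENNReal.ofReal (c * u * (u ^ (m - 1) * Real.exp (-(c * u)) * q s)) =
        ENNReal.ofReal (c * q s) * ∫⁻ u in Ioi (0 : ℝ),
          ENNReal.ofReal (u ^ (m + 1 - 1) * Real.exp (-(c * u))) := by
      rw [← lintegral_const_mul _ (by fun_prop)]
      refine setLIntegral_congr_fun measurableSet_Ioi fun u hu => ?_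
      have hu : (0 : ℝ) < u := hu
      rw [← ENNReal.ofReal_mul (mul_nonneg hc.le (hq0 s))]
      congr 1
      rw [show m + 1 - 1 = (m - 1) + 1 by ring, Real.rpow_add_one hu.ne']
      ring
    rw [this, lintegral_gamma_kernel (by linarith) hc, hA1,
      ← ENNReal.ofReal_mul (mul_nonneg hm.le (hq0 s)),
      ← ENNReal.ofReal_mul (mul_nonneg hc.le (hq0 s)), Real.Gamma_add_one hm.ne',
      Real.rpow_add_one (by positivity)]
    congr 1
    field_simp
  have hAfin : A ≠ ⊤ := by
    rw [hA1]; exact ENNReal.mul_ne_top ENNReal.ofReal_ne_top ENNReal.ofReal_ne_top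
  -- Adding the finite `A` to both sides, in its two forms, avoids subtraction in `ℝ≥0∞`; what
  -- remains is the pointwise bound `(c u - m) (q u - q s) ≥ 0`.
  rw [← ENNReal.add_le_add_iff_right hAfin]
  nth_rewrite 1 [hA2]
  rw [← lintegral_const_mul _ (by fun_prop), ← lintegral_add_left (by fun_prop), hA,
    ← lintegral_add_left (by fun_prop)]
  refine setLIntegral_mono (by fun_prop) fun u hu => ?_
  have hu : (0 : ℝ) < u := hu
  have hw : 0 ≤ u ^ (m - 1) * Real.exp (-(c * u)) := by positivity
  have h1 := hq0 u
  have h2 := hq0 s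
  rw [← ENNReal.ofReal_mul hm.le, ← ENNReal.ofReal_add (by positivity) (by positivity),
    ← ENNReal.ofReal_add (by positivity) (by positivity)]
  refine ENNReal.ofReal_le_ofReal ?_
  have key : 0 ≤ (c * u - m) * (q u - q s) := by
    have hms : m = c * s := by rw [hs]; field_simp
    rcases le_total u s with h | h
    · refine mul_nonneg_of_nonpos_of_nonpos ?_ (sub_nonpos.2 (hq hu hs0 h))
      rw [hms]; nlinarith
    · refine mul_nonneg ?_ (sub_nonneg.2 (hq hs0 hu h))
      rw [hms]; nlinarith
  nlinarith [mul_nonneg hw key]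

/-! ### Densities and the change of variables `(X, S) → (y, u)` -/

/-- Both finite measures have the same characteristic function, by the Fourier transform of a
Gaussian after translating by `θ`. Later only the positivity of the constant matters. -/
lemma multivariateGaussian_eq_withDensity {p : ℕ} (θ : EuclideanSpace ℝ (Fin p)) {σ : ℝ}
    (hσ : 0 < σ) : ∃ C : ℝ, 0 < C ∧
      multivariateGaussian θ (σ ^ 2 • (1 : Matrix (Fin p) (Fin p) ℝ)) =
        volume.withDensity
          (fun x => ENNReal.ofReal (C * Real.exp (-(1 / (2 * σ ^ 2)) * ‖x - θ‖ ^ 2))) := by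
  set b : ℝ := 1 / (2 * σ ^ 2) with hb
  have hb0 : 0 < b := by positivity
  set K : ℝ := (Real.pi / b) ^ ((p : ℝ) / 2) with hK
  have hK0 : 0 < K := by positivity
  have hps : (σ ^ 2 • (1 : Matrix (Fin p) (Fin p) ℝ)).PosSemidef :=
    Matrix.PosSemidef.one.smul (sq_nonneg σ)
  have hint : Integrable (fun x : EuclideanSpace ℝ (Fin p) => Real.exp (-b * ‖x - θ‖ ^ 2)) := by
    have h := (GaussianFourier.integrable_cexp_neg_mul_sq_norm_add (b := (b : ℂ))
      (by simpa using hb0) 0 (0 : EuclideanSpace ℝ (Fin p))).re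
    have h' : Integrable (fun x : EuclideanSpace ℝ (Fin p) => Real.exp (-b * ‖x‖ ^ 2)) := by
      refine h.congr (Filter.Eventually.of_forall fun x => ?_)
      simp only [zero_mul, add_zero]
      rw [show (-(b : ℂ) * (‖x‖ : ℂ) ^ 2) = ((-b * ‖x‖ ^ 2 : ℝ) : ℂ) by push_cast; ring,
        ← Complex.ofReal_exp]
      rfl
    exact h'.comp_sub_right θ
  refine ⟨K⁻¹, by positivity, ?_⟩
  have hfin : IsFiniteMeasure ((volume : Measure (EuclideanSpace ℝ (Fin p))).withDensity
      (fun x => ENNReal.ofReal (K⁻¹ * Real.exp (-b * ‖x - θ‖ ^ 2)))) :=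
    isFiniteMeasure_withDensity_ofReal (hint.const_mul K⁻¹).2
  refine Measure.ext_of_charFun ?_
  ext t
  rw [charFun_multivariateGaussian hps, charFun_apply,
    integral_withDensity_eq_integral_toReal_smul (by fun_prop) (by simp)]
  have h1 := GaussianFourier.integral_cexp_neg_mul_sq_norm_add (b := (b : ℂ))
      (by simpa using hb0) Complex.I t
  set F : EuclideanSpace ℝ (Fin p) → ℂ := fun v =>
    ((K⁻¹ : ℝ) : ℂ) * Complex.exp ((inner ℝ t θ : ℝ) * Complex.I) *
      Complex.exp (-(b : ℂ) * (‖v‖ : ℂ) ^ 2 + Complex.I * (inner ℝ t v : ℝ)) with hF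
  have h2 : ∀ x : EuclideanSpace ℝ (Fin p),
      (ENNReal.ofReal (K⁻¹ * Real.exp (-b * ‖x - θ‖ ^ 2))).toReal •
        Complex.exp ((inner ℝ x t : ℝ) * Complex.I) =
      F (x - θ) := by
    intro x
    simp only [hF]
    rw [ENNReal.toReal_ofReal (by positivity), Complex.real_smul, inner_sub_right,
      real_inner_comm t x, Complex.ofReal_mul, Complex.ofReal_exp, mul_assoc, mul_assoc,
      ← Complex.exp_add, ← Complex.exp_add]
    congr 2
    push_cast
    ring
  rw [integral_congr_ae (Filter.Eventually.of_forall h2), integral_sub_right_eq_self F θ, hF,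
    integral_const_mul, h1]
  have h3 : ((Real.pi : ℂ) / (b : ℂ)) ^
      (((Module.finrank ℝ (EuclideanSpace ℝ (Fin p)) : ℕ) : ℂ) / 2) = (K : ℂ) := by
    rw [hK, Complex.ofReal_cpow (by positivity)]
    simp
  rw [h3, mul_comm ((K⁻¹ : ℝ) : ℂ), mul_assoc, ← mul_assoc ((K⁻¹ : ℝ) : ℂ), ← Complex.ofReal_mul,
    inv_mul_cancel₀ hK0.ne', Complex.ofReal_one, one_mul, ← Complex.exp_add]
  congr 1
  have h4 : t.ofLp ⬝ᵥ (σ ^ 2 • (1 : Matrix (Fin p) (Fin p) ℝ)).mulVec t.ofLp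
      = σ ^ 2 * ‖t‖ ^ 2 := by
    rw [Matrix.smul_mulVec, Matrix.one_mulVec, dotProduct_smul, EuclideanSpace.real_norm_sq_eq]
    simp [dotProduct, sq]
  have hσc : (σ : ℂ) ≠ 0 := by exact_mod_cast hσ.ne'
  rw [h4, Complex.I_sq, hb]
  push_cast
  field_simp
  ring

lemma lintegral_gammaMeasure {a : ℝ} {f : ℝ → ℝ≥0∞} (hf : Measurable f) :
    ∫⁻ u, f u ∂(gammaMeasure a (1 / 2)) =
      ∫⁻ u in Ioi (0 : ℝ), ENNReal.ofReal ((1 / 2) ^ a / Real.Gamma a *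
        (u ^ (a - 1) * Real.exp (-(1 / 2 * u)))) * f u := by
  have hpdf : Measurable (gammaPDF a (1 / 2)) := (measurable_gammaPDFReal _ _).ennreal_ofReal
  rw [gammaMeasure, lintegral_withDensity_eq_lintegral_mul _ hpdf hf,
    ← lintegral_add_compl _ (measurableSet_Ici (a := (0 : ℝ))), compl_Ici]
  have h0 : ∫⁻ u in Iio (0 : ℝ), (gammaPDF a (1 / 2) * f) u = 0 := by
    rw [setLIntegral_congr_fun (g := fun _ => 0) measurableSet_Iio, lintegral_zero]
    intro u hu
    simp [gammaPDF_of_neg hu]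
  rw [h0, add_zero, ← restrict_Ioi_eq_restrict_Ici]
  refine setLIntegral_congr_fun measurableSet_Ioi fun u hu => ?_
  simp only [Pi.mul_apply]
  rw [gammaPDF_of_nonneg (le_of_lt hu), mul_assoc]

lemma lintegral_comp_smul_pos {p : ℕ} {f : EuclideanSpace ℝ (Fin p) → ℝ≥0∞} (hf : Measurable f)
    {r : ℝ} (hr : 0 < r) :
    ∫⁻ x, f x = ENNReal.ofReal (r ^ p) * ∫⁻ y, f (r • y) := by
  have h : ∫⁻ y, f (r • y) = ∫⁻ x, f x ∂(Measure.map (fun y => r • y) volume) :=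
    (lintegral_map hf (by fun_prop)).symm
  rw [h, Measure.map_addHaar_smul _ hr.ne', lintegral_smul_measure, smul_eq_mul, ← mul_assoc,
    ← ENNReal.ofReal_mul (by positivity), finrank_euclideanSpace_fin, abs_of_pos (by positivity),
    mul_inv_cancel₀ (by positivity), ENNReal.ofReal_one, one_mul]

instance isProbabilityMeasure_model {p n : ℕ} [NeZero n] (θ : EuclideanSpace ℝ (Fin p)) (σ : ℝ) :
    IsProbabilityMeasure (model p n θ σ) := by
  have hn : (0 : ℝ) < n := by exact_mod_cast Nat.pos_of_ne_zero (NeZero.ne n)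
  have := isProbabilityMeasure_gammaMeasure (a := (n : ℝ) / 2) (r := 1 / 2) (by positivity)
    (by norm_num)
  have := Measure.isProbabilityMeasure_map (μ := gammaMeasure ((n : ℝ) / 2) (1 / 2))
    (f := fun u => σ ^ 2 * u) (by fun_prop)
  unfold model
  infer_instance

/-- Integration against the model in the coordinates `y = X / √u`, `u = S / σ²`. -/
lemma exists_lintegral_model {p n : ℕ} (hn : 1 ≤ n) (θ : EuclideanSpace ℝ (Fin p)) {σ : ℝ}
    (hσ : 0 < σ) : ∃ C : ℝ, 0 < C ∧
      ∀ G : EuclideanSpace ℝ (Fin p) × ℝ → ℝ≥0∞, Measurable G →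
        ∫⁻ z, G z ∂(model p n θ σ) =
          ∫⁻ y : EuclideanSpace ℝ (Fin p), ∫⁻ u in Ioi (0 : ℝ),
            ENNReal.ofReal (C * (u ^ (((n : ℝ) + p) / 2 - 1) * Real.exp (-(1 / 2 * u)) *
              Real.exp (-(1 / (2 * σ ^ 2)) * ‖√u • y - θ‖ ^ 2))) * G (√u • y, σ ^ 2 * u) := by
  have hn0 : (0 : ℝ) < n := by exact_mod_cast hn
  obtain ⟨C₁, hC₁, h₁⟩ := multivariateGaussian_eq_withDensity θ hσ
  set C₂ : ℝ := (1 / 2) ^ ((n : ℝ) / 2) / Real.Gamma ((n : ℝ) / 2) with hC₂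
  have hC₂0 : 0 < C₂ := div_pos (by positivity) (Real.Gamma_pos_of_pos (by positivity))
  refine ⟨C₁ * C₂, by positivity, fun G hG => ?_⟩
  have := isProbabilityMeasure_gammaMeasure (a := (n : ℝ) / 2) (r := 1 / 2) (by positivity)
    (by norm_num)
  have := Measure.isProbabilityMeasure_map (μ := gammaMeasure ((n : ℝ) / 2) (1 / 2))
    (f := fun u => σ ^ 2 * u) (by fun_prop)
  have hm : Measurable fun s : ℝ =>
      ∫⁻ x, G (x, s) ∂(multivariateGaussian θ (σ ^ 2 • (1 : Matrix (Fin p) (Fin p) ℝ))) :=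
    hG.lintegral_prod_left'
  have hm' : Measurable fun u : ℝ => ∫⁻ x, G (x, σ ^ 2 * u)
      ∂(multivariateGaussian θ (σ ^ 2 • (1 : Matrix (Fin p) (Fin p) ℝ))) :=
    hm.comp (measurable_const_mul (σ ^ 2))
  rw [model, lintegral_prod_symm' _ hG, lintegral_map hm (by fun_prop),
    lintegral_gammaMeasure hm', h₁, lintegral_lintegral_swap]
  · refine setLIntegral_congr_fun measurableSet_Ioi fun u hu => ?_
    have hu : (0 : ℝ) < u := hu
    have hGu : Measurable fun x => G (x, σ ^ 2 * u) := by fun_prop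
    simp only [← hC₂]
    rw [lintegral_withDensity_eq_lintegral_mul _ (by fun_prop) hGu,
      lintegral_comp_smul_pos (by fun_prop) (Real.sqrt_pos.2 hu), ← mul_assoc,
      ← ENNReal.ofReal_mul (by positivity), ← lintegral_const_mul _ (by fun_prop)]
    refine lintegral_congr fun y => ?_
    simp only [Pi.mul_apply]
    rw [← mul_assoc, ← ENNReal.ofReal_mul (by positivity)]
    congr 2
    -- The Jacobian `√u ^ p` of `x = √u • y` raises the gamma shape from `n/2` to `(n + p)/2`.
    have h : u ^ (((n : ℝ) + p) / 2 - 1) = u ^ ((n : ℝ) / 2 - 1) * √u ^ p := by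
      rw [Real.sqrt_eq_rpow, ← Real.rpow_natCast, ← Real.rpow_mul hu.le, ← Real.rpow_add hu]
      congr 1
      ring
    rw [h]
    ring
  · refine Measurable.aemeasurable ?_
    unfold Function.uncurry
    fun_prop

/-! ### The moment inequality for `S` and `W` -/

/-- The conditional second moment inequality for `S` given `W`, in weak form. -/
lemma lintegral_mul_snd_le {p n : ℕ} (hn : 1 ≤ n) {k : ℝ → ℝ≥0∞} (hk : Measurable k)
    (θ : EuclideanSpace ℝ (Fin p)) {σ : ℝ} (hσ : 0 < σ) :
    ENNReal.ofReal ((n + p + 2) * σ ^ 2) *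
        ∫⁻ z, k (statW z) * ENNReal.ofReal z.2 ∂(model p n θ σ) ≤
      ∫⁻ z, k (statW z) * ENNReal.ofReal (z.2 ^ 2 * (1 + statW z)) ∂(model p n θ σ) := by
  have hn0 : (0 : ℝ) < n := by exact_mod_cast hn
  have hW : Measurable (statW : EuclideanSpace ℝ (Fin p) × ℝ → ℝ) := by
    unfold statW; fun_prop
  obtain ⟨C, hC, hint⟩ := exists_lintegral_model hn θ hσ
  rw [hint _ (by fun_prop), hint _ (by fun_prop)]
  set b : ℝ := 1 / (2 * σ ^ 2) with hb
  have hb0 : 0 < b := by positivity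
  -- The extra `1` absorbs the factor `S`; then `2 m = n + p + 2`, the constant of the statement.
  -- The rate `c y` below is `(1 + W)/2`, and `q` is the cross term of `‖√u • y - θ‖²`.
  set m : ℝ := ((n : ℝ) + p) / 2 + 1 with hm
  have hm0 : 0 < m := by positivity
  set c : EuclideanSpace ℝ (Fin p) → ℝ := fun y => 1 / 2 + b * ‖y‖ ^ 2 with hc
  have hc0 : ∀ y, 0 < c y := fun y => by positivity
  set q : EuclideanSpace ℝ (Fin p) → ℝ → ℝ :=
    fun y u => Real.exp (2 * b * inner ℝ y θ * √u) with hq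
  set D : ℝ := C * Real.exp (-b * ‖θ‖ ^ 2) * σ ^ 2 with hD
  have hD0 : 0 < D := by positivity
  set F₁ : EuclideanSpace ℝ (Fin p) → ℝ≥0∞ := fun y => k (‖y‖ ^ 2 / σ ^ 2) *
    (ENNReal.ofReal D * ∫⁻ u in Ioi (0 : ℝ),
      ENNReal.ofReal (u ^ (m - 1) * Real.exp (-(c y * u)) * q y u)) with hF₁
  set F₂ : EuclideanSpace ℝ (Fin p) → ℝ≥0∞ := fun y => k (‖y‖ ^ 2 / σ ^ 2) *
    (ENNReal.ofReal (D * (2 * σ ^ 2)) * ∫⁻ u in Ioi (0 : ℝ),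
      ENNReal.ofReal (c y * u * (u ^ (m - 1) * Real.exp (-(c y * u)) * q y u))) with hF₂
  have hstat : ∀ (y : EuclideanSpace ℝ (Fin p)) (u : ℝ), 0 < u →
      statW (√u • y, σ ^ 2 * u) = ‖y‖ ^ 2 / σ ^ 2 := by
    intro y u hu
    simp only [statW, norm_smul, mul_pow, Real.norm_eq_abs, sq_abs, Real.sq_sqrt hu.le]
    field_simp
  have hdens : ∀ (y : EuclideanSpace ℝ (Fin p)) (u : ℝ), 0 < u →
      C * (u ^ (((n : ℝ) + p) / 2 - 1) * Real.exp (-(1 / 2 * u)) *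
        Real.exp (-b * ‖√u • y - θ‖ ^ 2)) * (σ ^ 2 * u) =
      D * (u ^ (m - 1) * Real.exp (-(c y * u)) * q y u) := by
    intro y u hu
    have h1 : u ^ (m - 1) = u ^ (((n : ℝ) + p) / 2 - 1) * u := by
      rw [← Real.rpow_add_one hu.ne', hm]
      congr 1
      ring
    have h2 : Real.exp (-(1 / 2 * u)) * Real.exp (-b * ‖√u • y - θ‖ ^ 2) =
        Real.exp (-b * ‖θ‖ ^ 2) * (Real.exp (-(c y * u)) * q y u) := by
      simp only [hq, hc]
      rw [← Real.exp_add, ← Real.exp_add, ← Real.exp_add, norm_sub_sq_real, norm_smul, mul_pow,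
        Real.norm_eq_abs, sq_abs, Real.sq_sqrt hu.le, real_inner_smul_left]
      congr 1
      ring
    rw [h1, hD]
    linear_combination C * u ^ (((n : ℝ) + p) / 2 - 1) * σ ^ 2 * u * h2
  have e₁ : ∀ y : EuclideanSpace ℝ (Fin p), (∫⁻ u in Ioi (0 : ℝ),
      ENNReal.ofReal (C * (u ^ (((n : ℝ) + p) / 2 - 1) * Real.exp (-(1 / 2 * u)) *
        Real.exp (-b * ‖√u • y - θ‖ ^ 2))) * (k (statW (√u • y, σ ^ 2 * u)) *
          ENNReal.ofReal (σ ^ 2 * u))) = F₁ y := by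
    intro y
    simp only [hF₁]
    rw [← lintegral_const_mul _ (by fun_prop), ← lintegral_const_mul _ (by fun_prop)]
    refine setLIntegral_congr_fun measurableSet_Ioi fun u hu => ?_
    have hu : (0 : ℝ) < u := hu
    simp only [hstat y u hu]
    rw [← ENNReal.ofReal_mul hD0.le, ← hdens y u hu, mul_left_comm,
      ← ENNReal.ofReal_mul (by positivity)]
  have e₂ : ∀ y : EuclideanSpace ℝ (Fin p), (∫⁻ u in Ioi (0 : ℝ),
      ENNReal.ofReal (C * (u ^ (((n : ℝ) + p) / 2 - 1) * Real.exp (-(1 / 2 * u)) *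
        Real.exp (-b * ‖√u • y - θ‖ ^ 2))) * (k (statW (√u • y, σ ^ 2 * u)) *
          ENNReal.ofReal ((σ ^ 2 * u) ^ 2 * (1 + statW (√u • y, σ ^ 2 * u))))) = F₂ y := by
    intro y
    simp only [hF₂]
    rw [← lintegral_const_mul _ (by fun_prop), ← lintegral_const_mul _ (by fun_prop)]
    refine setLIntegral_congr_fun measurableSet_Ioi fun u hu => ?_
    have hu : (0 : ℝ) < u := hu
    simp only [hstat y u hu]
    rw [mul_left_comm, ← ENNReal.ofReal_mul (by positivity),
      ← ENNReal.ofReal_mul (by positivity)]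
    congr 2
    have h3 : 1 + ‖y‖ ^ 2 / σ ^ 2 = 2 * c y := by
      simp only [hc, hb]
      field_simp
    rw [h3]
    linear_combination (2 * c y * σ ^ 2 * u) * hdens y u hu
  simp only [e₁, e₂]
  have hF₁m : Measurable F₁ := by
    have : Measurable fun y : EuclideanSpace ℝ (Fin p) => ∫⁻ u in Ioi (0 : ℝ),
        ENNReal.ofReal (u ^ (m - 1) * Real.exp (-(c y * u)) * q y u) :=
      Measurable.lintegral_prod_right' (f := fun z : EuclideanSpace ℝ (Fin p) × ℝ =>
        ENNReal.ofReal (z.2 ^ (m - 1) * Real.exp (-(c z.1 * z.2)) * q z.1 z.2)) (by fun_prop)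
    fun_prop
  have hF₂m : Measurable F₂ := by
    have : Measurable fun y : EuclideanSpace ℝ (Fin p) => ∫⁻ u in Ioi (0 : ℝ),
        ENNReal.ofReal (c y * u * (u ^ (m - 1) * Real.exp (-(c y * u)) * q y u)) :=
      Measurable.lintegral_prod_right' (f := fun z : EuclideanSpace ℝ (Fin p) × ℝ =>
        ENNReal.ofReal (c z.1 * z.2 * (z.2 ^ (m - 1) * Real.exp (-(c z.1 * z.2)) * q z.1 z.2)))
        (by fun_prop)
    fun_prop
  -- For a single `y`, `q y` decreases in `u` when `⟪y, θ⟫ < 0`, so the comparison is made on the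
  -- pair `±y`, which share the same `W`.
  have hsym : ∀ F : EuclideanSpace ℝ (Fin p) → ℝ≥0∞, Measurable F →
      2 * ∫⁻ y, F y = ∫⁻ y, (F y + F (-y)) := by
    intro F hF
    rw [lintegral_add_left hF, lintegral_neg_eq_self F, two_mul]
  have hpt : ∀ y, ENNReal.ofReal ((n + p + 2) * σ ^ 2) * (F₁ y + F₁ (-y)) ≤ F₂ y + F₂ (-y) := by
    intro y
    have hcy : c (-y) = c y := by simp [hc]
    have hqn : ∀ u, q y u + q (-y) u = 2 * Real.cosh (2 * b * inner ℝ y θ * √u) := by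
      intro u
      simp only [hq, inner_neg_left, Real.cosh_eq]
      ring_nf
    have hmono : MonotoneOn (fun u => q y u + q (-y) u) (Ioi 0) := by
      intro u hu v hv huv
      simp only [hqn]
      refine mul_le_mul_of_nonneg_left ?_ zero_le_two
      rw [Real.cosh_le_cosh, abs_mul, abs_mul _ (√v), abs_of_nonneg (Real.sqrt_nonneg _),
        abs_of_nonneg (Real.sqrt_nonneg _)]
      exact mul_le_mul_of_nonneg_left (Real.sqrt_le_sqrt huv) (abs_nonneg _)
    have hmain := lintegral_gamma_kernel_mul_monotone_le hm0 (hc0 y) hmono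
      (fun u => by positivity) (by fun_prop)
    have s₁ : F₁ y + F₁ (-y) = k (‖y‖ ^ 2 / σ ^ 2) * (ENNReal.ofReal D * ∫⁻ u in Ioi (0 : ℝ),
        ENNReal.ofReal (u ^ (m - 1) * Real.exp (-(c y * u)) * (q y u + q (-y) u))) := by
      simp only [hF₁, norm_neg, hcy]
      rw [← mul_add, ← mul_add, ← lintegral_add_left (by fun_prop)]
      congr 2
      refine setLIntegral_congr_fun measurableSet_Ioi fun u hu => ?_
      have hu : (0 : ℝ) < u := hu
      rw [← ENNReal.ofReal_add (by positivity) (by positivity), mul_add]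
    have s₂ : F₂ y + F₂ (-y) = k (‖y‖ ^ 2 / σ ^ 2) * (ENNReal.ofReal (D * (2 * σ ^ 2)) *
        ∫⁻ u in Ioi (0 : ℝ), ENNReal.ofReal
          (c y * u * (u ^ (m - 1) * Real.exp (-(c y * u)) * (q y u + q (-y) u)))) := by
      simp only [hF₂, norm_neg, hcy]
      rw [← mul_add, ← mul_add, ← lintegral_add_left (by fun_prop)]
      congr 2
      refine setLIntegral_congr_fun measurableSet_Ioi fun u hu => ?_
      have hu : (0 : ℝ) < u := hu
      have := hc0 y
      rw [← ENNReal.ofReal_add (by positivity) (by positivity), mul_add, mul_add]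
    rw [s₁, s₂, mul_left_comm, ← mul_assoc (ENNReal.ofReal _) (ENNReal.ofReal D),
      ← ENNReal.ofReal_mul (by positivity),
      show ((n : ℝ) + p + 2) * σ ^ 2 * D = D * (2 * σ ^ 2) * m by rw [hm]; ring,
      ENNReal.ofReal_mul (by positivity), mul_assoc]
    gcongr
  have h2 : (2 : ℝ≥0∞) ≠ 0 := by simp
  rw [← ENNReal.mul_le_mul_iff_right h2 (by simp : (2 : ℝ≥0∞) ≠ ⊤), mul_left_comm,
    hsym _ hF₁m, hsym _ hF₂m,
    ← lintegral_const_mul _ (by fun_prop)]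
  exact lintegral_mono hpt

/-! ### Null and non-null events for `W` -/

lemma measurable_statW {p : ℕ} : Measurable (statW : EuclideanSpace ℝ (Fin p) × ℝ → ℝ) := by
  unfold statW
  fun_prop

lemma ae_model_pos {p n : ℕ} (hp : 1 ≤ p) (hn : 1 ≤ n) (θ : EuclideanSpace ℝ (Fin p)) {σ : ℝ}
    (hσ : 0 < σ) : ∀ᵐ z ∂(model p n θ σ), 0 < z.2 ∧ 0 < statW z := by
  have : Nonempty (Fin p) := ⟨⟨0, hp⟩⟩
  obtain ⟨C, -, hint⟩ := exists_lintegral_model hn θ hσ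
  have hA : MeasurableSet {z : EuclideanSpace ℝ (Fin p) × ℝ | ¬(0 < z.2 ∧ 0 < statW z)} :=
    ((measurableSet_lt measurable_const measurable_snd).inter
      (measurableSet_lt measurable_const measurable_statW)).compl
  rw [ae_iff, ← lintegral_indicator_one hA, hint _ (measurable_one.indicator hA)]
  refine (lintegral_congr_ae ?_).trans lintegral_zero
  filter_upwards [Measure.ae_ne volume (0 : EuclideanSpace ℝ (Fin p))] with y hy
  refine (setLIntegral_congr_fun (g := fun _ => 0) measurableSet_Ioi fun u hu => ?_).trans
    lintegral_zero
  have hu : (0 : ℝ) < u := hu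
  have hy' : 0 < ‖y‖ := norm_pos_iff.2 hy
  have h : (√u • y, σ ^ 2 * u) ∉
      {z : EuclideanSpace ℝ (Fin p) × ℝ | ¬(0 < z.2 ∧ 0 < statW z)} := by
    simp only [mem_ofPred_eq, not_not, statW, norm_smul, Real.norm_eq_abs]
    constructor <;> positivity
  simp only [indicator_of_notMem h, mul_zero]

/-- In the coordinates `(y, u)` the event is a nonempty open punctured ball of `y` times all `u >
0`, where the density is positive. -/
lemma model_statW_lt_ne_zero {p n : ℕ} (hp : 1 ≤ p) (hn : 1 ≤ n) (θ : EuclideanSpace ℝ (Fin p))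
    {σ w : ℝ} (hσ : 0 < σ) (hw : 0 < w) :
    model p n θ σ {z | 0 < z.2 ∧ 0 < statW z ∧ statW z < w} ≠ 0 := by
  have : Nonempty (Fin p) := ⟨⟨0, hp⟩⟩
  obtain ⟨C, hC, hint⟩ := exists_lintegral_model hn θ hσ
  set A : Set (EuclideanSpace ℝ (Fin p) × ℝ) := {z | 0 < z.2 ∧ 0 < statW z ∧ statW z < w} with hAd
  have hA : MeasurableSet A :=
    (measurableSet_lt measurable_const measurable_snd).inter
      ((measurableSet_lt measurable_const measurable_statW).inter
        (measurableSet_lt measurable_statW measurable_const))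
  have hA1 : Measurable (A.indicator (1 : EuclideanSpace ℝ (Fin p) × ℝ → ℝ≥0∞)) :=
    measurable_one.indicator hA
  intro h0
  rw [← lintegral_indicator_one hA, hint _ hA1, lintegral_eq_zero_iff] at h0
  swap
  · exact Measurable.lintegral_prod_right' (f := fun z : EuclideanSpace ℝ (Fin p) × ℝ =>
      ENNReal.ofReal (C * (z.2 ^ (((n : ℝ) + p) / 2 - 1) * Real.exp (-(1 / 2 * z.2)) *
        Real.exp (-(1 / (2 * σ ^ 2)) * ‖√z.2 • z.1 - θ‖ ^ 2))) *
          A.indicator 1 (√z.2 • z.1, σ ^ 2 * z.2)) (by fun_prop)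
  set V : Set (EuclideanSpace ℝ (Fin p)) := {y | 0 < ‖y‖ ∧ ‖y‖ ^ 2 / σ ^ 2 < w} with hV
  have hVo : IsOpen V := by
    refine IsOpen.and ?_ ?_
    · exact isOpen_lt (by fun_prop) (by fun_prop)
    · exact isOpen_lt (by fun_prop) (by fun_prop)
  have hVn : V.Nonempty := by
    obtain ⟨y, hy⟩ := exists_norm_eq (EuclideanSpace ℝ (Fin p))
      (by positivity : 0 ≤ σ * √(w / 2))
    refine ⟨y, ?_, ?_⟩
    · rw [hy]; positivity
    · rw [hy, mul_pow, Real.sq_sqrt (by positivity)]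
      field_simp
      linarith
  refine hVo.measure_ne_zero volume hVn (measure_mono_null (fun y hy => ?_) h0)
  have hy1 : 0 < ‖y‖ := hy.1
  have hy2 : ‖y‖ ^ 2 / σ ^ 2 < w := hy.2
  simp only [mem_compl_iff, mem_ofPred_eq, Pi.zero_apply]
  intro h
  rw [lintegral_eq_zero_iff (by fun_prop)] at h
  have h' : ∀ᵐ u ∂(volume.restrict (Ioi (0 : ℝ))), False := by
    filter_upwards [h, ae_restrict_mem measurableSet_Ioi] with u hu hu0
    have hu0 : (0 : ℝ) < u := hu0
    have hmem : (√u • y, σ ^ 2 * u) ∈ A := by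
      have hs : statW (√u • y, σ ^ 2 * u) = ‖y‖ ^ 2 / σ ^ 2 := by
        simp only [statW, norm_smul, mul_pow, Real.norm_eq_abs, sq_abs, Real.sq_sqrt hu0.le]
        field_simp
      refine ⟨by positivity, ?_, ?_⟩
      · rw [hs]; positivity
      · rwa [hs]
    rw [indicator_of_mem hmem] at hu
    simp only [Pi.one_apply, mul_one, Pi.zero_apply, ENNReal.ofReal_eq_zero] at hu
    exact absurd hu (not_le.2 (by positivity))
  rw [ae_iff] at h'
  simp at h'

/-! ### Bounds on the risk reduction -/

/-- The risk of the unbiased estimator `X`. -/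
lemma mse_fst {p n : ℕ} (hn : 1 ≤ n) (θ : EuclideanSpace ℝ (Fin p)) (σ : ℝ) :
    mse p n (fun z => z.1) θ σ = ENNReal.ofReal (p * σ ^ 2) := by
  have hn0 : (0 : ℝ) < n := by exact_mod_cast hn
  set G := multivariateGaussian θ (σ ^ 2 • (1 : Matrix (Fin p) (Fin p) ℝ)) with hG
  have hps : (σ ^ 2 • (1 : Matrix (Fin p) (Fin p) ℝ)).PosSemidef :=
    Matrix.PosSemidef.one.smul (sq_nonneg σ)
  have := isProbabilityMeasure_gammaMeasure (a := (n : ℝ) / 2) (r := 1 / 2) (by positivity)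
    (by norm_num)
  have := Measure.isProbabilityMeasure_map (μ := gammaMeasure ((n : ℝ) / 2) (1 / 2))
    (f := fun u => σ ^ 2 * u) (by fun_prop)
  have hfst : mse p n (fun z => z.1) θ σ = ∫⁻ x, ENNReal.ofReal (‖x - θ‖ ^ 2) ∂G := by
    rw [mse, model, lintegral_prod _ (by fun_prop)]
    refine lintegral_congr fun x => ?_
    simp only [lintegral_const, measure_univ, mul_one]
  have hcoord : ∀ i, ∫⁻ x, ENNReal.ofReal ((x i - θ i) ^ 2) ∂G = ENNReal.ofReal (σ ^ 2) := by
    intro i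
    have hmp := measurePreserving_eval_multivariateGaussian (μ := θ) hps (i := i)
    have hmean : ∫ x, x i ∂G = θ i := by
      have h := integral_map (μ := G) (φ := fun x => x i) (f := id) hmp.aemeasurable
        (by fun_prop)
      rw [hmp.map_eq] at h
      simpa using h.symm
    have h := ofReal_variance (X := fun x => x i) (μ := G)
      ((IsGaussian.memLp_two_id).comp_measurePreserving hmp)
    rw [evariance_eq_lintegral_ofReal, variance_eval_multivariateGaussian hps, hmean] at h
    simpa using h.symm
  have hsum : ∀ x : EuclideanSpace ℝ (Fin p), ENNReal.ofReal (‖x - θ‖ ^ 2) =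
      ∑ i, ENNReal.ofReal ((x i - θ i) ^ 2) := by
    intro x
    rw [EuclideanSpace.real_norm_sq_eq, ENNReal.ofReal_sum_of_nonneg fun i _ => sq_nonneg _]
    simp
  rw [hfst]
  simp only [hsum]
  rw [lintegral_finsetSum _ fun i _ => by fun_prop]
  simp [hcoord, ENNReal.ofReal_mul]

lemma riskReduction_nonneg {p n : ℕ} (hn : 1 ≤ n) {φ : ℝ → ℝ} (himp : ImprovesOnX p n (delta φ))
    (θ : EuclideanSpace ℝ (Fin p)) {σ : ℝ} (hσ : 0 < σ) : 0 ≤ riskReduction p n φ θ σ := by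
  have h := himp.1 θ σ hσ
  rw [mse_fst hn] at h
  exact sub_nonneg.2 (ENNReal.toReal_le_of_le_ofReal (by positivity) h)

/-- Strict improvement at one parameter gives a positive reduction there, and `α` dominates it. -/
lemma alpha_pos {p n : ℕ} (hn : 1 ≤ n) {φ : ℝ → ℝ} (himp : ImprovesOnX p n (delta φ))
    (hmax : ∀ (θ : EuclideanSpace ℝ (Fin p)) (σ : ℝ), 0 < σ →
      riskReduction p n φ θ σ / σ ^ 2 ≤ alpha p n φ) : 0 < alpha p n φ := by
  obtain ⟨θ, σ, hσ, h⟩ := himp.2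
  refine lt_of_lt_of_le (div_pos ?_ (by positivity)) (hmax θ σ hσ)
  rw [mse_fst hn] at h
  rw [riskReduction, sub_pos]
  exact (ENNReal.lt_ofReal_iff_toReal_lt (ne_top_of_lt h)).1 h

/-! ### The truncation and its effect on the risk -/

/-- `ψ₁` truncates the estimator from above at `(1 + W₀) α / (n + p + 2)`. -/
lemma aFun_mul_psi1 {p n : ℕ} (hp : 0 < p) (hn : 0 < n) (φ : ℝ → ℝ) {W₀ : ℝ}
    (hκ : 0 < (1 + W₀) / (n + p + 2) * alpha p n φ) (w : ℝ) :
    p / n * aFun p n φ w * psi1 p n φ W₀ w =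
      min (p / n * aFun p n φ w) ((1 + W₀) / (n + p + 2) * alpha p n φ) := by
  have hp0 : (0 : ℝ) < p := by exact_mod_cast hp
  have hn0 : (0 : ℝ) < n := by exact_mod_cast hn
  unfold psi1
  split_ifs with h
  · rw [mul_min_of_nonneg _ _ (by positivity), mul_one]
    congr 1
    field_simp
  · rw [mul_one, min_eq_left]
    exact (mul_nonpos_of_nonneg_of_nonpos (by positivity) (not_lt.1 h)).trans hκ.le

variable {p n : ℕ} {φ : ℝ → ℝ}

/-- The part of `p a(W) / n` above the level `κ`, extended by `0` to `w ≤ 0`. -/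
noncomputable def excess (p n : ℕ) (φ : ℝ → ℝ) (κ w : ℝ) : ℝ :=
  (Ioi (0 : ℝ)).indicator (fun w => max (p / n * aFun p n φ w - κ) 0) w

lemma excess_nonneg (κ w : ℝ) : 0 ≤ excess p n φ κ w :=
  indicator_nonneg (fun _ _ => le_max_right _ _) w

lemma excess_of_pos (κ : ℝ) {w : ℝ} (hw : 0 < w) :
    excess p n φ κ w = max (p / n * aFun p n φ w - κ) 0 :=
  indicator_of_mem (show w ∈ Ioi (0 : ℝ) from hw) _

lemma measurable_indicator_aFun (hanti : AntitoneOn (aFun p n φ) (Ioi 0)) :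
    Measurable ((Ioi (0 : ℝ)).indicator (aFun p n φ)) := by
  refine measurable_of_restrict_of_restrict_compl (measurableSet_Ioi (a := (0 : ℝ))) ?_ ?_
  · refine Antitone.measurable fun x y hxy => ?_
    simp only [domRestrict_apply, indicator_of_mem x.2, indicator_of_mem y.2]
    exact hanti x.2 y.2 hxy
  · have : (Ioi (0 : ℝ))ᶜ.domRestrict ((Ioi (0 : ℝ)).indicator (aFun p n φ)) = fun _ => 0 := by
      ext x
      simp only [domRestrict_apply]
      exact indicator_of_notMem x.2 _
    rw [this]
    exact measurable_const

lemma measurable_excess (hanti : AntitoneOn (aFun p n φ) (Ioi 0)) (κ : ℝ) :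
    Measurable (excess p n φ κ) := by
  have h : excess p n φ κ = (Ioi (0 : ℝ)).indicator
      (fun w => max (p / n * (Ioi (0 : ℝ)).indicator (aFun p n φ) w - κ) 0) := by
    ext w
    unfold excess
    by_cases hw : w ∈ Ioi (0 : ℝ)
    · simp only [indicator_of_mem hw]
    · simp only [indicator_of_notMem hw]
  rw [h]
  have := measurable_indicator_aFun hanti
  exact Measurable.indicator (by fun_prop) measurableSet_Ioi

/-- The truncation lowers the risk at least by the second moment of the truncated part. -/
lemma reductionRisk_psi1_add_le (hp : 1 ≤ p) (hn : 1 ≤ n)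
    (himp : ImprovesOnX p n (delta φ))
    (hmax : ∀ (θ : EuclideanSpace ℝ (Fin p)) (σ : ℝ), 0 < σ →
      riskReduction p n φ θ σ / σ ^ 2 ≤ alpha p n φ)
    (hanti : AntitoneOn (aFun p n φ) (Ioi 0)) {W₀ κ : ℝ} (hW₀ : 0 < W₀)
    (hκ : κ = (1 + W₀) / (n + p + 2) * alpha p n φ) (hκa : κ = p / n * aFun p n φ W₀)
    (θ : EuclideanSpace ℝ (Fin p)) {σ : ℝ} (hσ : 0 < σ)
    (hfin : reductionRisk p n φ (reductionEst0 p n φ) θ σ ≠ ⊤) :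
    reductionRisk p n φ (reductionEst p n φ (psi1 p n φ W₀)) θ σ +
        ∫⁻ z, ENNReal.ofReal ((z.2 * excess p n φ κ (statW z)) ^ 2) ∂(model p n θ σ) ≤
      reductionRisk p n φ (reductionEst0 p n φ) θ σ := by
  have : NeZero n := ⟨by omega⟩
  have hp0 : (0 : ℝ) < p := by exact_mod_cast hp
  have hn0 : (0 : ℝ) < n := by exact_mod_cast hn
  have hα := alpha_pos hn himp hmax
  have hκ0 : 0 < κ := by rw [hκ]; positivity
  set R := riskReduction p n φ θ σ with hR
  have hR0 : 0 ≤ R := riskReduction_nonneg hn himp θ hσ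
  have hRα : R ≤ alpha p n φ * σ ^ 2 := (div_le_iff₀ (by positivity)).1 (hmax θ σ hσ)
  set μ := model p n θ σ with hμ
  set d : EuclideanSpace ℝ (Fin p) × ℝ → ℝ := fun z => z.2 * excess p n φ κ (statW z) with hd
  have hkm := measurable_excess hanti κ
  have hsm := measurable_statW (p := p)
  have hdm : Measurable d := by fun_prop
  have hpos := ae_model_pos (n := n) hp hn θ hσ
  have hT0 : ∀ z : EuclideanSpace ℝ (Fin p) × ℝ,
      reductionEst0 p n φ z = z.2 * (p / n * aFun p n φ (statW z)) := fun z => by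
    rw [reductionEst0]; ring
  have hT1 : ∀ z : EuclideanSpace ℝ (Fin p) × ℝ,
      reductionEst p n φ (psi1 p n φ W₀) z = z.2 * min (p / n * aFun p n φ (statW z)) κ :=
    fun z => by
    rw [hκ, ← aFun_mul_psi1 hp hn φ (hκ ▸ hκ0), reductionEst]; ring
  have hsplit : ∀ z, 0 < z.2 → 0 < statW z →
      reductionEst0 p n φ z = reductionEst p n φ (psi1 p n φ W₀) z + d z ∧
      d z * reductionEst p n φ (psi1 p n φ W₀) z = d z * (κ * z.2) := by
    intro z hz hw
    simp only [hT0, hT1, hd, excess_of_pos κ hw]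
    rcases le_total (p / n * aFun p n φ (statW z)) κ with h | h
    · rw [min_eq_left h, max_eq_right (by linarith)]
      constructor <;> ring
    · rw [min_eq_right h, max_eq_left (by linarith)]
      constructor <;> ring
  have hd0 : ∀ z, 0 < z.2 → 0 ≤ d z := fun z hz => mul_nonneg hz.le (excess_nonneg _ _)
  -- Needed to cancel the cross term at the end. Where `d > 0`, `T₁ = κ S > 0`, so `d ≤ T₀ ≤ (T₀ -
  -- R)² + R + 1`.
  have hdfin : ∫⁻ z, ENNReal.ofReal (d z) ∂μ ≠ ⊤ := by
    have h : ∫⁻ z, ENNReal.ofReal (d z) ∂μ ≤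
        reductionRisk p n φ (reductionEst0 p n φ) θ σ + ENNReal.ofReal (R + 1) := by
      have hc : ENNReal.ofReal (R + 1) = ∫⁻ _, ENNReal.ofReal (R + 1) ∂μ := by
        rw [lintegral_const, measure_univ, mul_one]
      rw [reductionRisk, hc, ← lintegral_add_right _ measurable_const]
      refine lintegral_mono_ae ?_
      filter_upwards [hpos] with z hz
      rw [← ENNReal.ofReal_add (sq_nonneg _) (by positivity)]
      refine ENNReal.ofReal_le_ofReal ?_
      obtain ⟨h1, h2⟩ := hsplit z hz.1 hz.2
      have h3 := hd0 z hz.1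
      rcases h3.eq_or_lt with h4 | h4
      · rw [← h4]; positivity
      · have h5 := mul_left_cancel₀ h4.ne' h2
        have h6 : 0 < κ * z.2 := mul_pos hκ0 hz.1
        nlinarith [sq_nonneg (reductionEst0 p n φ z - R - 1 / 2)]
    exact ne_top_of_le_ne_top (ENNReal.add_ne_top.2 ⟨hfin, ENNReal.ofReal_ne_top⟩) h
  have hcross : ENNReal.ofReal (2 * R) * ∫⁻ z, ENNReal.ofReal (d z) ∂μ ≤
      ∫⁻ z, ENNReal.ofReal (2 * d z * (κ * z.2)) ∂μ := by
    have hkey := lintegral_mul_snd_le hn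
      (k := fun w => ENNReal.ofReal (excess p n φ κ w)) (by fun_prop) θ hσ
    have h1 : ∫⁻ z, ENNReal.ofReal (excess p n φ κ (statW z)) * ENNReal.ofReal z.2 ∂μ =
        ∫⁻ z, ENNReal.ofReal (d z) ∂μ := by
      refine lintegral_congr fun z => ?_
      rw [← ENNReal.ofReal_mul (excess_nonneg _ _), mul_comm]
    rw [← hμ, h1] at hkey
    -- Chosen so that `t (n + p + 2) σ² = 2 α σ² ≥ 2 R` and `t (1 + W₀) = 2 κ`.
    set t : ℝ := 2 * alpha p n φ / (n + p + 2) with ht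
    have ht0 : 0 < t := by positivity
    calc ENNReal.ofReal (2 * R) * ∫⁻ z, ENNReal.ofReal (d z) ∂μ
        ≤ ENNReal.ofReal (t * ((n + p + 2) * σ ^ 2)) * ∫⁻ z, ENNReal.ofReal (d z) ∂μ := by
          refine mul_le_mul_left (ENNReal.ofReal_le_ofReal ?_) _
          have : t * (((n : ℝ) + p + 2) * σ ^ 2) = 2 * (alpha p n φ * σ ^ 2) := by
            rw [ht]; field_simp
          linarith
      _ ≤ ENNReal.ofReal t * ∫⁻ z, ENNReal.ofReal (excess p n φ κ (statW z)) *
            ENNReal.ofReal (z.2 ^ 2 * (1 + statW z)) ∂μ := by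
          rw [ENNReal.ofReal_mul ht0.le, mul_assoc]
          gcongr
      _ ≤ _ := by
          rw [← lintegral_const_mul _ (by fun_prop)]
          refine lintegral_mono_ae ?_
          filter_upwards [hpos] with z hz
          rw [← ENNReal.ofReal_mul (excess_nonneg _ _), ← ENNReal.ofReal_mul ht0.le]
          refine ENNReal.ofReal_le_ofReal ?_
          have e : 2 * d z * (κ * z.2) =
              t * (excess p n φ κ (statW z) * (z.2 ^ 2 * (1 + W₀))) := by
            simp only [hd, ht, hκ]; field_simp
          rw [e]
          rcases le_total W₀ (statW z) with h | h
          · have h0 : excess p n φ κ (statW z) = 0 := by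
              rw [excess_of_pos κ hz.2, max_eq_right]
              rw [hκa, sub_nonpos]
              exact mul_le_mul_of_nonneg_left (hanti hW₀ hz.2 h) (by positivity)
            simp [h0]
          · have := excess_nonneg (p := p) (n := n) (φ := φ) κ (statW z)
            gcongr
  -- The expanded square, with the negative cross term moved to the left. Additivity of the integral
  -- needs only the added terms measurable, so nothing is asked of the two estimators.
  have hsum : reductionRisk p n φ (reductionEst0 p n φ) θ σ +
        ENNReal.ofReal (2 * R) * ∫⁻ z, ENNReal.ofReal (d z) ∂μ =
      reductionRisk p n φ (reductionEst p n φ (psi1 p n φ W₀)) θ σ +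
        ∫⁻ z, ENNReal.ofReal (d z ^ 2) ∂μ + ∫⁻ z, ENNReal.ofReal (2 * d z * (κ * z.2)) ∂μ := by
    rw [reductionRisk, reductionRisk, ← lintegral_const_mul _ (by fun_prop),
      ← lintegral_add_right _ (by fun_prop), ← lintegral_add_right _ (by fun_prop),
      ← lintegral_add_right _ (by fun_prop)]
    refine lintegral_congr_ae ?_
    filter_upwards [hpos] with z hz
    obtain ⟨h1, h2⟩ := hsplit z hz.1 hz.2
    have h3 := hd0 z hz.1
    have h4 := hz.1
    rw [← ENNReal.ofReal_mul (by positivity), ← ENNReal.ofReal_add (by positivity) (by positivity),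
      ← ENNReal.ofReal_add (by positivity) (by positivity),
      ← ENNReal.ofReal_add (by positivity) (by positivity), h1]
    congr 1
    linear_combination 2 * h2
  have hRd : ENNReal.ofReal (2 * R) * ∫⁻ z, ENNReal.ofReal (d z) ∂μ ≠ ⊤ :=
    ENNReal.mul_ne_top ENNReal.ofReal_ne_top hdfin
  rw [← ENNReal.add_le_add_iff_right hRd, hsum]
  gcongr

/-- Monotonicity spreads an excess at the single point `w` to all of `(0, w)`, an event of positive
probability. -/
lemma lintegral_excess_ne_zero (hp : 1 ≤ p) (hn : 1 ≤ n)
    (hanti : AntitoneOn (aFun p n φ) (Ioi 0)) {κ w : ℝ} (hw : 0 < w)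
    (hκw : κ < p / n * aFun p n φ w) (θ : EuclideanSpace ℝ (Fin p)) {σ : ℝ} (hσ : 0 < σ) :
    ∫⁻ z, ENNReal.ofReal ((z.2 * excess p n φ κ (statW z)) ^ 2) ∂(model p n θ σ) ≠ 0 := by
  have hkm := measurable_excess hanti κ
  have hsm := measurable_statW (p := p)
  rw [Ne, lintegral_eq_zero_iff (by fun_prop)]
  intro h
  refine model_statW_lt_ne_zero hp hn θ hσ hw (measure_mono_null (fun z hz => ?_) h)
  obtain ⟨h1, h2, h3⟩ : 0 < z.2 ∧ 0 < statW z ∧ statW z < w := hz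
  have h4 : p / n * aFun p n φ w ≤ p / n * aFun p n φ (statW z) :=
    mul_le_mul_of_nonneg_left (hanti h2 hw h3.le) (by positivity)
  have h5 : 0 < excess p n φ κ (statW z) := by
    rw [excess_of_pos κ h2]
    exact lt_max_of_lt_left (by linarith)
  simp only [mem_compl_iff, mem_ofPred_eq, Pi.zero_apply, ENNReal.ofReal_eq_zero, not_le]
  positivity

end ShrinkageMSE

/-! ### The theorem -/

theorem mainTheorem5 (p n : ℕ) (hp : 3 ≤ p) (hn : 1 ≤ n) (φ : ℝ → ℝ)
    (hφ : ∀ u v : ℝ, 0 < u → u ≤ v → AbsolutelyContinuousOnInterval φ u v)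
    (hint : ∀ w : ℝ, 0 < w → IntegrableOn (ShrinkageMSE.gIntegrand p n φ) (Set.Ioi w))
    (himp : ShrinkageMSE.ImprovesOnX p n (ShrinkageMSE.delta φ))
    (hmax : ∀ (θ : EuclideanSpace ℝ (Fin p)) (σ : ℝ), 0 < σ →
      ShrinkageMSE.riskReduction p n φ θ σ / σ ^ 2 ≤ ShrinkageMSE.alpha p n φ)
    (hanti : AntitoneOn (ShrinkageMSE.aFun p n φ) (Set.Ioi 0))
    (W₀ : ℝ) (hW₀ : 0 < W₀)
    (heq : (1 + W₀) / ShrinkageMSE.aFun p n φ W₀ =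
      p * (n + p + 2) / n * (1 / ShrinkageMSE.alpha p n φ)) :
    (∀ (θ : EuclideanSpace ℝ (Fin p)) (σ : ℝ), 0 < σ →
      ShrinkageMSE.reductionRisk p n φ
          (ShrinkageMSE.reductionEst p n φ (ShrinkageMSE.psi1 p n φ W₀)) θ σ ≤
        ShrinkageMSE.reductionRisk p n φ (ShrinkageMSE.reductionEst0 p n φ) θ σ) ∧
    ((∃ w : ℝ, 0 < w ∧ ShrinkageMSE.psi1 p n φ W₀ w ≠ 1) →
      ∀ (θ : EuclideanSpace ℝ (Fin p)) (σ : ℝ), 0 < σ →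
        ShrinkageMSE.reductionRisk p n φ
            (ShrinkageMSE.reductionEst p n φ (ShrinkageMSE.psi1 p n φ W₀)) θ σ ≠ ⊤ →
        ShrinkageMSE.reductionRisk p n φ
            (ShrinkageMSE.reductionEst p n φ (ShrinkageMSE.psi1 p n φ W₀)) θ σ <
          ShrinkageMSE.reductionRisk p n φ (ShrinkageMSE.reductionEst0 p n φ) θ σ) := by
  have hp1 : 1 ≤ p := by omega
  have hp0 : (0 : ℝ) < p := by exact_mod_cast hp1
  have hn0 : (0 : ℝ) < n := by exact_mod_cast hn
  have hα := ShrinkageMSE.alpha_pos hn himp hmax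
  obtain ⟨κ, hκ⟩ : ∃ κ : ℝ, κ = (1 + W₀) / (n + p + 2) * ShrinkageMSE.alpha p n φ := ⟨_, rfl⟩
  have hκ0 : 0 < κ := by rw [hκ]; positivity
  -- If `a(W₀)` were `0`, division by zero would make the left side of `heq` equal to `0`, while its
  -- right side is positive.
  have ha : ShrinkageMSE.aFun p n φ W₀ ≠ 0 := by
    intro h
    rw [h, div_zero] at heq
    exact absurd heq (ne_of_lt (by positivity))
  have hκa : κ = p / n * ShrinkageMSE.aFun p n φ W₀ := by
    rw [hκ]
    field_simp at heq ⊢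
    linear_combination heq
  refine ⟨fun θ σ hσ => ?_, fun ⟨w, hw, hψ⟩ θ σ hσ hfin₁ => ?_⟩
  · by_cases hfin : ShrinkageMSE.reductionRisk p n φ (ShrinkageMSE.reductionEst0 p n φ) θ σ = ⊤
    · rw [hfin]; exact le_top
    · exact le_self_add.trans (ShrinkageMSE.reductionRisk_psi1_add_le hp1 hn himp hmax hanti hW₀
        hκ hκa θ hσ hfin)
  · by_cases hfin : ShrinkageMSE.reductionRisk p n φ (ShrinkageMSE.reductionEst0 p n φ) θ σ = ⊤
    · rw [hfin]; exact hfin₁.lt_top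
    · refine lt_of_lt_of_le (ENNReal.lt_add_right hfin₁ ?_)
        (ShrinkageMSE.reductionRisk_psi1_add_le hp1 hn himp hmax hanti hW₀ hκ hκa θ hσ hfin)
      refine ShrinkageMSE.lintegral_excess_ne_zero hp1 hn hanti hw ?_ θ hσ
      -- Where the cap `κ` is not exceeded, `ψ₁` equals `1`; so `ψ₁ w ≠ 1` forces an excess at `w`.
      by_contra! hle
      have h := ShrinkageMSE.aFun_mul_psi1 hp1 hn φ (hκ ▸ hκ0) w
      rw [← hκ, min_eq_left hle] at h
      by_cases h0 : 0 < ShrinkageMSE.aFun p n φ w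
      · exact hψ (mul_left_cancel₀ (a := p / n * ShrinkageMSE.aFun p n φ w) (by positivity)
          (by rw [h, mul_one]))
      · exact hψ (by rw [ShrinkageMSE.psi1, if_neg h0])
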